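/- Let $n\ge1$ and $d\ge0$ be integers, let $\|\cdot\|$ be any norm on $\mathbb{C}^{n\times n}$, and let $\eta_i$ ($1\le i\le n$) be the least positive constant such that $\|A^{(i)}\|_2\le\eta_i\|A\|$ for all $A\in\mathbb{C}^{n\times n}$, where $A^{(i)}$ is the $i$-th column of $A$ and $\|\cdot\|_2$ is the Euclidean norm; put $\eta:=\eta_1\cdots\eta_n$. Let $P(\lambda)=A_0+A_1\lambda+\dots+A_d\lambda^d$ with $A_j\in\mathbb{C}^{n\times n}$, $A_d\neq 0$ and $\det A_0\ne0$, and let $c:=|\det A_0|/\|A_0\|^n$. Let $\zeta_1,\dots,\zeta_{nd}$ be the eigenvalues of $P$ arranged by non-decreasing modulus, i.e. the roots of $\det P(\lambda)$ counted with multiplicities, together with the eigenvalue $\infty$ (of modulus $+\infty$) with multiplicity $nd-\deg\det P$. Let $\alpha_1\le\dots\le\alpha_d$ be the tropical roots of $\mathsf{t}p(x)=\max_{0\le j\le d}\|A_j\|x^j$, i.e. the nonnegative numbers such that $\mathsf{t}p(x)=\|A_d\|\prod_{i=1}^d\max(x,\alpha_i)$ for all $x\ge0$. Let $k_0=0<k_1<\dots<k_q=d$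 be the abscissae of all the vertices of the Newton polygon of $\mathsf{t}p$, i.e. of the extreme points of the convex hull of $\{(j,y)\in\mathbb{N}\times\mathbb{R} : 0\le j\le d,\ A_j\neq0,\ y\le\log\|A_j\|\}$. Let $\delta_j:=\alpha_{k_j}/\alpha_{k_j+1}$ with the conventions $\alpha_0=0$ and $\alpha_{d+1}=+\infty$ (so $\delta_0=\delta_q=0$). For $0\le k\le nd$ let $C_{n,d,k}$ be the number of maps $\phi:\{1,\dots,n\}\to\{0,\dots,d\}$ with $\sum_{i=1}^n\phi(i)=k$. Then $C_{n,d,k}\le(\min(d,k,nd-k)+1)^{n-1}$ for all $0\le k\le nd$, and for every $j=1,\dots,q$, if $$c_j:=\frac{|\det A_{k_j}|}{\|A_{k_j}\|^n}-(C_{n,d,nk_j}-1)\,\eta\,\delta_j>0,$$ then $$\frac{|\zeta_1\cdots\zeta_{nk_j}|}{(\alpha_1\cdots\alpha_{k_j})^n}\le\frac{c}{c_j}\binom{nd}{nk_j}.$$ -/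

import Mathlib

open Polynomial

noncomputable section

namespace MatrixPolyBound

/-- The matrix polynomial `A 0 + A 1 * X + ... + A d * X ^ d`, as a matrix with polynomial
entries. Only the coefficients `A 0, ..., A d` play a role. -/
def matPoly {n : ℕ} (A : ℕ → Matrix (Fin n) (Fin n) ℂ) (d : ℕ) : Matrix (Fin n) (Fin n) ℂ[X] :=
  ∑ j ∈ Finset.range (d + 1), (X ^ j : ℂ[X]) • (A j).map C

/-- The `n * d` eigenvalues, with multiplicities, of a regular `n × n` matrix polynomial of
degree `d`: the roots of its determinant, and the eigenvalue `∞` with multiplicity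
`n * d` minus the degree of the determinant (so `∞` is absent if `A d` is invertible). -/
def eigenvalues {n : ℕ} (A : ℕ → Matrix (Fin n) (Fin n) ℂ) (d : ℕ) : Multiset (OnePoint ℂ) :=
  (matPoly A d).det.roots.map (fun z : ℂ => (z : OnePoint ℂ)) +
    Multiset.replicate (n * d - (matPoly A d).det.natDegree) OnePoint.infty

/-- The modulus on `ℂ ∪ {∞}`, with `|∞| = ∞`. -/
def modulus (z : OnePoint ℂ) : ENNReal :=
  OnePoint.elim z (⊤ : ENNReal) (fun w : ℂ => ENNReal.ofReal ‖w‖)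

/-- `ζ 1, ..., ζ (n * d)` are the eigenvalues, arranged by non-decreasing modulus. -/
def IsEigenvalueSeq {n : ℕ} (A : ℕ → Matrix (Fin n) (Fin n) ℂ) (d : ℕ)
    (ζ : ℕ → OnePoint ℂ) : Prop :=
  (Finset.Icc 1 (n * d)).val.map ζ = eigenvalues A d ∧
    MonotoneOn (fun i => modulus (ζ i)) (Set.Icc 1 (n * d))

/-- The max-times polynomial function `x ↦ max_{0 ≤ j ≤ d} a j * x ^ j`. -/
def tropEval (a : ℕ → ℝ) (d : ℕ) (x : ℝ) : ℝ :=
  (Finset.range (d + 1)).sup' Finset.nonempty_range_add_one (fun j => a j * x ^ j)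

/-- `α 1 ≤ ... ≤ α d` are the tropical roots (with multiplicities) of the max-times polynomial
with coefficients `a 0, ..., a d`: it factors as `a d * ∏ max (x, α i)` for all `x ≥ 0`. -/
def IsTropicalRoots (a : ℕ → ℝ) (d : ℕ) (α : ℕ → ℝ) : Prop :=
  MonotoneOn α (Set.Icc 1 d) ∧ (∀ i ∈ Set.Icc 1 d, 0 ≤ α i) ∧
    ∀ x : ℝ, 0 ≤ x → tropEval a d x = a d * ∏ i ∈ Finset.Icc 1 d, max x (α i)

/-- The points `(j, y)` with `0 ≤ j ≤ d` and `y ≤ log (a j)`, where `log 0 = -∞`. -/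
def newtonRegion (a : ℕ → ℝ) (d : ℕ) : Set (ℝ × ℝ) :=
  {p | ∃ j : ℕ, j ≤ d ∧ a j ≠ 0 ∧ p.1 = (j : ℝ) ∧ p.2 ≤ Real.log (a j)}

/-- `k` is the abscissa of a vertex of the Newton polygon, that is, of an extreme point of the
convex hull of the region. -/
def IsVertexAbscissa (a : ℕ → ℝ) (d k : ℕ) : Prop :=
  ∃ y : ℝ, ((k : ℝ), y) ∈ (convexHull ℝ (newtonRegion a d)).extremePoints ℝ

/-- The separation parameter `α k / α (k + 1)`, with `α 0 = 0` and `α (d + 1) = ∞`. -/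
def separation (d : ℕ) (α : ℕ → ℝ) (k : ℕ) : ℝ :=
  if k = 0 ∨ k = d then 0 else α k / α (k + 1)

/-- The least positive `t` such that the Euclidean norm of the `i`-th column of `M` is at most
`t * N M` for all `M`. -/
def columnConst {n : ℕ} (N : Seminorm ℂ (Matrix (Fin n) (Fin n) ℂ)) (i : Fin n) : ℝ :=
  sInf {t : ℝ | 0 < t ∧ ∀ M : Matrix (Fin n) (Fin n) ℂ,
    ‖(WithLp.toLp 2 (fun r => M r i) : EuclideanSpace ℂ (Fin n))‖ ≤ t * N M}

theorem exists_bound_of_finiteDimensional {E F : Type*} [AddCommGroup E] [Module ℂ E]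
    [FiniteDimensional ℂ E] [NormedAddCommGroup F] [NormedSpace ℂ F] (N : Seminorm ℂ E)
    (hN : ∀ x, N x = 0 → x = 0) (L : E →ₗ[ℂ] F) : ∃ t : ℝ, 0 < t ∧ ∀ x, ‖L x‖ ≤ t * N x := by
  let _ : NormedAddCommGroup E :=
    AddGroupNorm.toNormedAddCommGroup
      { toFun := N, map_zero' := map_zero N, add_le' := map_add_le_add N,
        neg' := map_neg_eq_map N, eq_zero_of_map_eq_zero' := hN }
  let _ : NormedSpace ℂ E := ⟨fun c x => (map_smul_eq_mul N c x).le⟩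
  refine ⟨‖L.toContinuousLinearMap‖ + 1, by positivity, fun x => ?_⟩
  have h1 : ‖L x‖ ≤ ‖L.toContinuousLinearMap‖ * N x := L.toContinuousLinearMap.le_opNorm x
  have h3 := apply_nonneg N x
  linarith

/-- The infimum defining `columnConst` is attained. -/
theorem isLeast_columnConst {n : ℕ} (N : Seminorm ℂ (Matrix (Fin n) (Fin n) ℂ))
    (hN : ∀ M : Matrix (Fin n) (Fin n) ℂ, N M = 0 → M = 0) (i : Fin n) :
    IsLeast {t : ℝ | 0 < t ∧ ∀ M : Matrix (Fin n) (Fin n) ℂ,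
      ‖(WithLp.toLp 2 (fun r => M r i) : EuclideanSpace ℂ (Fin n))‖ ≤ t * N M}
      (columnConst N i) := by
  set S := {t : ℝ | 0 < t ∧ ∀ M : Matrix (Fin n) (Fin n) ℂ,
    ‖(WithLp.toLp 2 (fun r => M r i) : EuclideanSpace ℂ (Fin n))‖ ≤ t * N M} with hS
  have hpos : ∀ M, M ≠ 0 → 0 < N M := fun M h =>
    lt_of_le_of_ne (apply_nonneg N M) (fun h' => h (hN M h'.symm))
  have hne : S.Nonempty :=
    exists_bound_of_finiteDimensional N hN
      { toFun := fun M => (WithLp.toLp 2 (fun r => M r i) : EuclideanSpace ℂ (Fin n))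
        map_add' := fun _ _ => rfl
        map_smul' := fun _ _ => rfl }
  have hbdd : BddBelow S := ⟨0, fun t ht => ht.1.le⟩
  have hle : ∀ M : Matrix (Fin n) (Fin n) ℂ,
      ‖(WithLp.toLp 2 (fun r => M r i) : EuclideanSpace ℂ (Fin n))‖ ≤ sInf S * N M := by
    intro M
    by_cases h : M = 0
    · subst h
      have : (WithLp.toLp 2 (fun r => (0 : Matrix (Fin n) (Fin n) ℂ) r i) :
        EuclideanSpace ℂ (Fin n)) = 0 := rfl
      rw [this]
      simp
    · rw [← div_le_iff₀ (hpos M h)]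
      exact le_csInf hne fun t ht => (div_le_iff₀ (hpos M h)).2 (ht.2 M)
  refine ⟨⟨?_, hle⟩, fun t ht => csInf_le hbdd ht⟩
  have h1 := hle 1
  have h2 : 0 < ‖(WithLp.toLp 2 (fun r => (1 : Matrix (Fin n) (Fin n) ℂ) r i) :
        EuclideanSpace ℂ (Fin n))‖ := by
    rw [norm_pos_iff]
    intro h
    have := congrArg (fun v : EuclideanSpace ℂ (Fin n) => v i) h
    simp at this
  change 0 < sInf S
  by_contra h3
  have := mul_nonpos_of_nonpos_of_nonneg (not_lt.1 h3)
    (apply_nonneg N (1 : Matrix (Fin n) (Fin n) ℂ))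
  linarith

/-- The number of maps `φ : {1, ..., n} → {0, ..., d}` with `∑ i, φ i = k`. -/
def mapCount (n d k : ℕ) : ℕ :=
  (Finset.univ.filter (fun φ : Fin n → Fin (d + 1) => ∑ i, (φ i : ℕ) = k)).card

/-- `|det M| / ‖M‖ ^ n`. -/
def detRatio {n : ℕ} (N : Seminorm ℂ (Matrix (Fin n) (Fin n) ℂ))
    (M : Matrix (Fin n) (Fin n) ℂ) : ℝ :=
  ‖M.det‖ / N M ^ n

/-- The constant `|det A_k| / ‖A_k‖ ^ n - (C_{n,d,nk} - 1) * η * δ`, where `η` is the product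
of the column constants and `δ` is the separation parameter at `k`. -/
def vertexConst {n : ℕ} (N : Seminorm ℂ (Matrix (Fin n) (Fin n) ℂ))
    (A : ℕ → Matrix (Fin n) (Fin n) ℂ) (d : ℕ) (α : ℕ → ℝ) (k : ℕ) : ℝ :=
  detRatio N (A k) -
    ((mapCount n d (n * k) : ℝ) - 1) * (∏ i, columnConst N i) * separation d α k

end MatrixPolyBound

end

open Polynomial

namespace MatrixPolyBound

/-! Write `p` for the scalar polynomial `det P`, of degree at most `nd`. By multilinearity, its
coefficient at `nk` is a sum of determinants of mixed matrices, one for each map `φ` of sum `nk`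
(`coeff_det_matPoly`). The constant map gives `det A_k`. By Hadamard's inequality any other term is
at most `η ∏ ‖A_(φ i)‖`. At a vertex `k` the norms decay by a factor `α_k` per step to the left and
`1 / α_(k+1)` per step to the right (`coeff_mul_pow_le`). As `φ` has mean `k`, there are as many
steps to the left as to the right, so the product is at most `‖A_k‖ ^ n * δ` (`prod_coeff_le`).
Hence `|p_(nk)| ≥ c_j ‖A_k‖ ^ n > 0`. Viète's formulas, applied to the finite eigenvalues, bound
`|ζ_1 ⋯ ζ_K| |p_K|` by `binom(nd, K) |p_0|` (`prod_modulus_mul_coeff_le`). With `K = nk`, `p_0 = det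
A_0` and `‖A_0‖ = ‖A_k‖ α_1 ⋯ α_k`, this is the claim. -/

/-- **Hadamard's inequality** for complex matrices. -/
theorem norm_det_le_prod_norm_col {n : ℕ} (M : Matrix (Fin n) (Fin n) ℂ) :
    ‖M.det‖ ≤ ∏ i, ‖(WithLp.toLp 2 (fun r => M r i) : EuclideanSpace ℂ (Fin n))‖ := by
  set f : Fin n → EuclideanSpace ℂ (Fin n) := fun i => WithLp.toLp 2 (fun r => M r i)
  have h : Module.finrank ℂ (EuclideanSpace ℂ (Fin n)) = Fintype.card (Fin n) := by simp
  let b := InnerProductSpace.gramSchmidtOrthonormalBasis h f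
  let e := EuclideanSpace.basisFun (Fin n) ℂ
  have h1 : M.det = e.toBasis.det f := by
    rw [Module.Basis.det_apply]
    congr 1
  have h2 : e.toBasis.det f = e.toBasis.det b * b.toBasis.det f := by
    rw [Module.Basis.det_apply, Module.Basis.det_apply, Module.Basis.det_apply, ← Matrix.det_mul,
      ← b.coe_toBasis, Module.Basis.toMatrix_mul_toMatrix]
  rw [h1, h2, norm_mul, e.det_to_matrix_orthonormalBasis b, one_mul,
    InnerProductSpace.gramSchmidtOrthonormalBasis_det, norm_prod]
  refine Finset.prod_le_prod (fun _ _ => norm_nonneg _) fun i _ => ?_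
  refine (norm_inner_le_norm _ _).trans ?_
  rw [OrthonormalBasis.norm_eq_one, one_mul]

/-! ### Expansion of the determinant into mixed determinants. -/

/-- The matrix whose `i`-th column is the `i`-th column of `A (φ i)`. -/
def mixedColumns {n : ℕ} (A : ℕ → Matrix (Fin n) (Fin n) ℂ) (φ : Fin n → ℕ) :
    Matrix (Fin n) (Fin n) ℂ :=
  Matrix.of fun r i => A (φ i) r i

theorem det_matPoly {n : ℕ} (A : ℕ → Matrix (Fin n) (Fin n) ℂ) (d : ℕ) :
    (matPoly A d).det = ∑ φ : Fin n → Fin (d + 1),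
      X ^ (∑ i, (φ i : ℕ)) * C (mixedColumns A (fun i => φ i)).det := by
  have h1 : (matPoly A d).transpose = fun i => ∑ j : Fin (d + 1),
      fun r => (X ^ (j : ℕ) : ℂ[X]) * C (A j r i) := by
    ext1 i
    rw [Fin.sum_univ_eq_sum_range (fun j => fun r => (X ^ j : ℂ[X]) * C (A j r i))]
    intro r
    simp [matPoly, Matrix.sum_apply, Finset.sum_apply]
  -- `Matrix.detRowAlternating` is multilinear in rows, whereas the expansion is by columns.
  rw [← Matrix.det_transpose, h1]
  have h2 := (Matrix.detRowAlternating (n := Fin n) (R := ℂ[X])).toMultilinearMap.map_sum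
    (fun (i : Fin n) (j : Fin (d + 1)) => fun r => (X ^ (j : ℕ) : ℂ[X]) * C (A j r i))
  refine h2.trans (Finset.sum_congr rfl fun φ _ => ?_)
  have h3 := Matrix.det_mul_column (fun i => (X ^ (φ i : ℕ) : ℂ[X]))
    ((mixedColumns A (fun i => φ i)).transpose.map C)
  rw [Finset.prod_pow_eq_pow_sum] at h3
  rw [← Matrix.det_transpose (mixedColumns A (fun i => φ i)), RingHom.map_det]
  exact h3

theorem coeff_det_matPoly {n : ℕ} (A : ℕ → Matrix (Fin n) (Fin n) ℂ) (d k : ℕ) :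
    (matPoly A d).det.coeff k =
      ∑ φ ∈ Finset.univ.filter (fun φ : Fin n → Fin (d + 1) => ∑ i, (φ i : ℕ) = k),
        (mixedColumns A (fun i => φ i)).det := by
  rw [det_matPoly, finsetSum_coeff, Finset.sum_filter]
  refine Finset.sum_congr rfl fun φ _ => ?_
  rw [coeff_mul_C, coeff_X_pow]
  simp [eq_comm]

theorem natDegree_det_matPoly_le {n : ℕ} (A : ℕ → Matrix (Fin n) (Fin n) ℂ) (d : ℕ) :
    (matPoly A d).det.natDegree ≤ n * d := by
  rw [natDegree_le_iff_coeff_eq_zero]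
  intro k hk
  rw [coeff_det_matPoly, Finset.filter_eq_empty_iff.2, Finset.sum_empty]
  intro φ _ h
  have : ∑ i, (φ i : ℕ) ≤ ∑ _i : Fin n, d := Finset.sum_le_sum fun i _ => by omega
  simp at this
  omega

/-! ### Counting maps with a given sum. -/

theorem mapCount_succ_le {n d k b : ℕ}
    (hb : ∀ φ : Fin (n + 1) → Fin (d + 1), ∑ i, (φ i : ℕ) = k → ∀ i, (φ i : ℕ) ≤ b) :
    mapCount (n + 1) d k ≤ (b + 1) ^ n := by
  have : (Finset.univ : Finset (Fin n → Fin (b + 1))).card = (b + 1) ^ n := by simp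
  rw [← this, mapCount]
  -- The first `n` values determine the last one, because the sum is fixed. Reduction modulo `b + 1`
  -- loses nothing, by `hb`.
  refine Finset.card_le_card_of_injOn
    (fun φ i => Fin.ofNat (b + 1) (φ i.castSucc : ℕ)) (fun _ _ => Finset.mem_coe.2 (Finset.mem_univ _)) ?_
  intro φ hφ ψ hψ h
  simp only [Finset.coe_filter, Finset.mem_univ, true_and, Set.mem_ofPred_eq] at hφ hψ
  have h1 : ∀ i : Fin n, (φ i.castSucc : ℕ) = ψ i.castSucc := by
    intro i
    have := congrArg Fin.val (congrFun h i)
    simp only [Fin.val_ofNat] at this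
    rwa [Nat.mod_eq_of_lt (Nat.lt_succ_of_le (hb φ hφ _)),
      Nat.mod_eq_of_lt (Nat.lt_succ_of_le (hb ψ hψ _))] at this
  have h2 : (φ (Fin.last n) : ℕ) = ψ (Fin.last n) := by
    rw [Fin.sum_univ_castSucc] at hφ hψ
    rw [Finset.sum_congr rfl fun i _ => h1 i] at hφ
    omega
  ext i
  exact Fin.lastCases h2 h1 i

/-- The reflection `φ ↦ d - φ` is injective and turns the sum into its complement. -/
theorem mapCount_le_mapCount_sub {n d k : ℕ} : mapCount n d k ≤ mapCount n d (n * d - k) := by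
  refine Finset.card_le_card_of_injOn (fun φ i => (φ i).rev) ?_ ?_
  · intro φ hφ
    simp only [Finset.coe_filter, Finset.mem_univ, true_and, Set.mem_ofPred_eq] at hφ ⊢
    have h : ∑ i, ((φ i).rev : ℕ) + ∑ i, (φ i : ℕ) = n * d := by
      rw [← Finset.sum_add_distrib,
        Finset.sum_congr rfl (g := fun _ => d) fun i _ => by rw [Fin.val_rev]; omega]
      simp
    omega
  · intro φ _ ψ _ h
    exact funext fun i => Fin.rev_injective (congrFun h i)

theorem mapCount_succ_le_min {n d k : ℕ} : mapCount (n + 1) d k ≤ (min d k + 1) ^ n := by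
  refine mapCount_succ_le fun φ hφ i => le_min (Nat.le_of_lt_succ (φ i).isLt) ?_
  rw [← hφ]
  exact Finset.single_le_sum (f := fun i => (φ i : ℕ)) (fun _ _ => Nat.zero_le _)
    (Finset.mem_univ i)

theorem mapCount_le {n d k : ℕ} (hn : n ≠ 0) :
    mapCount n d k ≤ (min d (min k (n * d - k)) + 1) ^ (n - 1) := by
  obtain ⟨n, rfl⟩ := Nat.exists_eq_succ_of_ne_zero hn
  rcases min_choice k ((n + 1) * d - k) with h | h <;> rw [Nat.succ_eq_add_one, h]
  · exact mapCount_succ_le_min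
  · exact mapCount_le_mapCount_sub.trans mapCount_succ_le_min

/-! ### Tropical roots and the concave hull of the coefficients. -/

theorem le_tropEval {a : ℕ → ℝ} {d m : ℕ} (hm : m ≤ d) (x : ℝ) : a m * x ^ m ≤ tropEval a d x :=
  Finset.le_sup' (fun j => a j * x ^ j) (Finset.mem_range.2 (Nat.lt_succ_of_le hm))

theorem exists_tropEval_eq (a : ℕ → ℝ) (d : ℕ) (x : ℝ) :
    ∃ m ≤ d, tropEval a d x = a m * x ^ m := by
  obtain ⟨m, hm, h⟩ := Finset.exists_mem_eq_sup' (Finset.nonempty_range_add_one (n := d))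
    (fun j => a j * x ^ j)
  exact ⟨m, Nat.le_of_lt_succ (Finset.mem_range.1 hm), h⟩

/-- The coefficient of index `m` of the concave max-times polynomial with leading coefficient `c`
and roots `α 1, ..., α d`. -/
def concaveCoeff (c : ℝ) (α : ℕ → ℝ) (d m : ℕ) : ℝ :=
  c * ∏ i ∈ Finset.Ioc m d, α i

theorem concaveCoeff_self (c : ℝ) (α : ℕ → ℝ) (d : ℕ) : concaveCoeff c α d d = c := by
  simp [concaveCoeff]

theorem concaveCoeff_eq_mul_prod (c : ℝ) (α : ℕ → ℝ) {d l m : ℕ} (hl : l ≤ m) (hm : m ≤ d) :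
    concaveCoeff c α d l = concaveCoeff c α d m * ∏ i ∈ Finset.Ioc l m, α i := by
  rw [concaveCoeff, concaveCoeff, ← Finset.prod_Ioc_consecutive α hl hm]
  ring

theorem prod_max_eq {α : ℕ → ℝ} {d m : ℕ} (hmono : MonotoneOn α (Set.Icc 1 d)) (hm : m ≤ d) {x : ℝ}
    (h1 : 1 ≤ m → α m ≤ x) (h2 : m < d → x ≤ α (m + 1)) :
    ∏ i ∈ Finset.Icc 1 d, max x (α i) = x ^ m * ∏ i ∈ Finset.Ioc m d, α i := by
  rw [show Finset.Icc 1 d = Finset.Ioc 0 d from rfl,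
    ← Finset.prod_Ioc_consecutive _ (Nat.zero_le m) hm]
  congr 1
  · rw [Finset.prod_congr rfl (g := fun _ => x)]
    · simp
    · intro i hi
      rw [Finset.mem_Ioc] at hi
      exact max_eq_left ((hmono ⟨hi.1, by omega⟩ ⟨by omega, hm⟩ hi.2).trans (h1 (by omega)))
  · refine Finset.prod_congr rfl fun i hi => ?_
    rw [Finset.mem_Ioc] at hi
    exact max_eq_right
      ((h2 (by omega)).trans (hmono ⟨by omega, by omega⟩ ⟨by omega, hi.2⟩ (by omega)))

namespace IsTropicalRoots

variable {a α : ℕ → ℝ} {d : ℕ}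

theorem tropEval_eq (h : IsTropicalRoots a d α) {m : ℕ} (hm : m ≤ d) {x : ℝ} (hx : 0 ≤ x)
    (h1 : 1 ≤ m → α m ≤ x) (h2 : m < d → x ≤ α (m + 1)) :
    tropEval a d x = concaveCoeff (a d) α d m * x ^ m := by
  rw [h.2.2 x hx, prod_max_eq h.1 hm h1 h2, concaveCoeff]
  ring

theorem tropEval_zero (h : IsTropicalRoots a d α) : tropEval a d 0 = concaveCoeff (a d) α d 0 := by
  rw [h.tropEval_eq (Nat.zero_le d) le_rfl (by omega) fun hd => h.2.1 1 ⟨le_rfl, hd⟩]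
  simp

theorem coeff_zero_eq (h : IsTropicalRoots a d α) (h0 : 0 < a 0) :
    a 0 = concaveCoeff (a d) α d 0 := by
  refine le_antisymm ?_ ?_
  · simpa [h.tropEval_zero] using le_tropEval (a := a) (Nat.zero_le d) 0
  · obtain ⟨m, -, h1⟩ := exists_tropEval_eq a d 0
    rw [← h.tropEval_zero, h1]
    rcases Nat.eq_zero_or_pos m with rfl | hm
    · simp
    · simp [hm.ne', h0.le]

theorem pos (h : IsTropicalRoots a d α) (h0 : 0 < a 0) {i : ℕ} (hi : 1 ≤ i) (hid : i ≤ d) :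
    0 < α i := by
  refine lt_of_le_of_ne (h.2.1 i ⟨hi, hid⟩) fun h1 => h0.ne' ?_
  rw [h.coeff_zero_eq h0, concaveCoeff,
    Finset.prod_eq_zero (Finset.mem_Ioc.2 ⟨hi, hid⟩) h1.symm, mul_zero]

theorem concaveCoeff_pos (h : IsTropicalRoots a d α) (h0 : 0 < a 0) (hd : 0 < a d) (m : ℕ) :
    0 < concaveCoeff (a d) α d m :=
  mul_pos hd (Finset.prod_pos fun i hi => by
    rw [Finset.mem_Ioc] at hi
    exact h.pos h0 (by omega) hi.2)

/-- At `x = α m` the hull monomial of index `m` realizes the maximum, so it dominates `a m * x ^ m`.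
-/
theorem coeff_le (h : IsTropicalRoots a d α) (h0 : 0 < a 0) {m : ℕ} (hm : m ≤ d) :
    a m ≤ concaveCoeff (a d) α d m := by
  rcases Nat.eq_zero_or_pos m with rfl | hm1
  · exact (h.coeff_zero_eq h0).le
  · have hp := h.pos h0 hm1 hm
    have h1 := le_tropEval (a := a) hm (α m)
    rw [h.tropEval_eq hm hp.le (fun _ => le_rfl)
      fun hmd => h.1 ⟨hm1, hm⟩ ⟨by omega, hmd⟩ (Nat.le_succ m)] at h1
    exact le_of_mul_le_mul_right h1 (pow_pos hp m)

/-- Moving the index away from `k` multiplies the monomial by factors `α i / x` (to the left) or `x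
/ α i` (to the right), all less than 1. -/
theorem concaveCoeff_mul_pow_lt (h : IsTropicalRoots a d α) (h0 : 0 < a 0) (hd : 0 < a d)
    {k m : ℕ} (hk : k ≤ d) (hm : m ≤ d) (hmk : m ≠ k) {x : ℝ} (hx : 0 < x)
    (h1 : 1 ≤ k → α k < x) (h2 : k < d → x < α (k + 1)) :
    concaveCoeff (a d) α d m * x ^ m < concaveCoeff (a d) α d k * x ^ k := by
  rcases lt_or_gt_of_ne hmk with hlt | hlt
  · rw [concaveCoeff_eq_mul_prod _ _ hlt.le hk, mul_assoc]
    refine mul_lt_mul_of_pos_left ?_ (h.concaveCoeff_pos h0 hd k)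
    have : ∏ i ∈ Finset.Ioc m k, α i < ∏ _i ∈ Finset.Ioc m k, x := by
      refine Finset.prod_lt_prod_of_nonempty ?_ ?_ (Finset.nonempty_Ioc.2 hlt)
      · intro i hi
        rw [Finset.mem_Ioc] at hi
        exact h.pos h0 (by omega) (by omega)
      · intro i hi
        rw [Finset.mem_Ioc] at hi
        exact (h.1 ⟨by omega, by omega⟩ ⟨by omega, hk⟩ hi.2).trans_lt (h1 (by omega))
    rw [Finset.prod_const, Nat.card_Ioc] at this
    calc _ < x ^ (k - m) * x ^ m := mul_lt_mul_of_pos_right this (pow_pos hx m)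
      _ = x ^ k := by rw [← pow_add, Nat.sub_add_cancel hlt.le]
  · rw [concaveCoeff_eq_mul_prod _ _ hlt.le hm, mul_assoc]
    refine mul_lt_mul_of_pos_left ?_ (h.concaveCoeff_pos h0 hd m)
    have : ∏ _i ∈ Finset.Ioc k m, x < ∏ i ∈ Finset.Ioc k m, α i := by
      refine Finset.prod_lt_prod_of_nonempty (fun _ _ => hx) ?_ (Finset.nonempty_Ioc.2 hlt)
      intro i hi
      rw [Finset.mem_Ioc] at hi
      exact (h2 (by omega)).trans_le (h.1 ⟨by omega, by omega⟩ ⟨by omega, by omega⟩ hi.1)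
    rw [Finset.prod_const, Nat.card_Ioc] at this
    calc x ^ m = x ^ (m - k) * x ^ k := by rw [← pow_add, Nat.sub_add_cancel hlt.le]
      _ < _ := mul_lt_mul_of_pos_right this (pow_pos hx k)

/-- At a strict jump of the tropical roots, the coefficient lies on the concave hull. -/
theorem coeff_eq_of_lt (h : IsTropicalRoots a d α) (h0 : 0 < a 0) (hd : 0 < a d) {k : ℕ}
    (hk : k ≤ d) (hlt : 1 ≤ k → k < d → α k < α (k + 1)) :
    a k = concaveCoeff (a d) α d k := by
  rcases Nat.eq_zero_or_pos k with rfl | hk0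
  · exact h.coeff_zero_eq h0
  rcases hk.eq_or_lt with rfl | hkd
  · rw [concaveCoeff_self]
  -- Strictly inside the gap, only the hull monomial of index `k` reaches the maximum, so the
  -- maximizing coefficient must be `a k` itself.
  obtain ⟨x, hx1, hx2⟩ := exists_between (hlt hk0 hkd)
  have hx : 0 < x := (h.pos h0 hk0 hk).trans hx1
  obtain ⟨m, hm, he⟩ := exists_tropEval_eq a d x
  rw [h.tropEval_eq hk hx.le (fun _ => hx1.le) (fun _ => hx2.le)] at he
  by_cases hmk : m = k
  · subst hmk
    exact (mul_right_cancel₀ (pow_pos hx m).ne' he).symm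
  · have h1 := h.concaveCoeff_mul_pow_lt h0 hd hk hm hmk hx (fun _ => hx1) fun _ => hx2
    have h2 := mul_le_mul_of_nonneg_right (h.coeff_le h0 hm) (pow_pos hx m).le
    linarith

end IsTropicalRoots

/-! ### Vertices of the Newton polygon are strict jumps of the roots. -/

theorem IsVertexAbscissa.le {a : ℕ → ℝ} {d k : ℕ} (hk : IsVertexAbscissa a d k) : k ≤ d := by
  obtain ⟨y, hy⟩ := hk
  obtain ⟨j, hj, -, h1, -⟩ := extremePoints_convexHull_subset hy
  have : k = j := Nat.cast_injective (R := ℝ) h1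
  omega

namespace IsTropicalRoots

variable {a α : ℕ → ℝ} {d : ℕ}

/-- If the two roots agreed, the log-hull would be affine on an interval `[l, r]` with `k` in its
interior, and a point over `k` could not be extreme. -/
theorem lt_of_isVertexAbscissa (h : IsTropicalRoots a d α) (h0 : 0 < a 0) (hd : 0 < a d) (ha : ∀ i, 0 ≤ a i)
    {k : ℕ} (hk : IsVertexAbscissa a d k) (hk1 : 1 ≤ k) (hkd : k < d) : α k < α (k + 1) := by
  have hle : α k ≤ α (k + 1) := h.1 ⟨hk1, hkd.le⟩ ⟨by omega, hkd⟩ (Nat.le_succ k)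
  refine lt_of_le_of_ne hle fun heq => ?_
  have hpk := h.pos h0 hk1 hkd.le
  -- the maximal interval `(l, r]` on which `α` is constant equal to `α k`
  have hex : ∃ l, α (l + 1) = α k := ⟨k - 1, by rw [Nat.sub_add_cancel hk1]⟩
  classical
  set l := Nat.find hex with hl
  have hlk : l < k := by
    have : l ≤ k - 1 := Nat.find_min' hex (by rw [Nat.sub_add_cancel hk1])
    omega
  set r := Nat.findGreatest (fun i => α i = α k) d with hr
  have hkr : k < r := Nat.le_findGreatest (P := fun i => α i = α k) hkd heq.symm
  have hrd : r ≤ d := Nat.findGreatest_le d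
  have hl1 : α (l + 1) = α k := Nat.find_spec hex
  have hr1 : α r = α k :=
    Nat.findGreatest_spec (P := fun i => α i = α k) (m := k) hkd.le rfl
  have hal : a l = concaveCoeff (a d) α d l := by
    refine h.coeff_eq_of_lt h0 hd (by omega) fun h1 h2 => ?_
    refine lt_of_le_of_ne (h.1 ⟨h1, h2.le⟩ ⟨by omega, h2⟩ (Nat.le_succ l)) fun h3 => ?_
    have : l ≤ l - 1 := Nat.find_min' hex (by rw [Nat.sub_add_cancel h1, h3, hl1])
    omega
  have har : a r = concaveCoeff (a d) α d r := by
    refine h.coeff_eq_of_lt h0 hd hrd fun h1 h2 => ?_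
    refine lt_of_le_of_ne (h.1 ⟨h1, h2.le⟩ ⟨by omega, h2⟩ (Nat.le_succ r)) fun h3 => ?_
    have : r + 1 ≤ r := Nat.le_findGreatest (P := fun i => α i = α k) h2 (by rw [← h3, hr1])
    omega
  have hconst : ∀ i, l < i → i ≤ r → α i = α k := by
    intro i h1 h2
    refine le_antisymm ?_ ?_
    · rw [← hr1]; exact h.1 ⟨by omega, by omega⟩ ⟨by omega, hrd⟩ h2
    · rw [← hl1]; exact h.1 ⟨by omega, by omega⟩ ⟨by omega, by omega⟩ h1
  have hlog : ∀ i, l ≤ i → i ≤ r → Real.log (concaveCoeff (a d) α d i) =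
      Real.log (a r) + ((r : ℝ) - i) * Real.log (α k) := by
    intro i h1 h2
    rw [concaveCoeff_eq_mul_prod _ _ h2 hrd, ← har,
      Finset.prod_congr rfl (g := fun _ => α k) fun j hj => ?_]
    · have hp : 0 < a r := har ▸ h.concaveCoeff_pos h0 hd r
      rw [Finset.prod_const, Nat.card_Ioc, Real.log_mul hp.ne' (pow_pos hpk _).ne', Real.log_pow,
        Nat.cast_sub h2]
    · rw [Finset.mem_Ioc] at hj
      exact hconst j (by omega) hj.2
  obtain ⟨y, hy⟩ := hk
  obtain ⟨j, hj, haj, h1, h2⟩ := extremePoints_convexHull_subset hy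
  obtain rfl : k = j := Nat.cast_injective (R := ℝ) h1
  -- Nothing yet forces `y` to lie on the hull. Lowering both endpoints by the gap `s` keeps them in
  -- the region and puts `(k, y)` on the segment.
  set s := Real.log (concaveCoeff (a d) α d k) - y with hs
  have hs0 : 0 ≤ s := by
    have := Real.log_le_log (lt_of_le_of_ne (ha k) (Ne.symm haj)) (h.coeff_le h0 hkd.le)
    simp only at h2
    linarith
  have hmem : ∀ m, m ≤ d → a m = concaveCoeff (a d) α d m →
      ((m : ℝ), Real.log (a m) - s) ∈ convexHull ℝ (newtonRegion a d) := fun m hm he =>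
    subset_convexHull ℝ _ ⟨m, hm, by rw [he]; exact (h.concaveCoeff_pos h0 hd m).ne', rfl,
      by simpa using hs0⟩
  have hlr : (0 : ℝ) < r - l := by
    have : (l : ℝ) < r := by exact_mod_cast hlk.trans hkr
    linarith
  have hlk' : (l : ℝ) < k := by exact_mod_cast hlk
  have hkr' : (k : ℝ) < r := by exact_mod_cast hkr
  have hseg : ((k : ℝ), y) ∈ openSegment ℝ ((l : ℝ), Real.log (a l) - s) ((r : ℝ), Real.log (a r) - s) := by
    refine ⟨(r - k) / (r - l), (k - l) / (r - l), div_pos (by linarith) hlr,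
      div_pos (by linarith) hlr, by field_simp; ring, ?_⟩
    have e1 := hlog l le_rfl (by omega)
    have e2 := hlog k hlk.le hkr.le
    rw [← hal] at e1
    have ey : y = Real.log (a r) + ((r : ℝ) - k) * Real.log (α k) - s := by rw [← e2]; ring
    ext
    · simp only [Prod.fst_add, Prod.smul_fst, smul_eq_mul]
      field_simp
      ring
    · simp only [Prod.snd_add, Prod.smul_snd, smul_eq_mul]
      rw [ey, e1]
      field_simp
      ring
  have hfin := hy.2 (hmem l (by omega) hal) (hmem r hrd har) hseg
  have := congrArg Prod.fst hfin
  simp only at this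
  linarith

theorem coeff_eq_of_isVertexAbscissa (h : IsTropicalRoots a d α) (h0 : 0 < a 0) (hd : 0 < a d)
    (ha : ∀ i, 0 ≤ a i) {k : ℕ} (hk : IsVertexAbscissa a d k) :
    a k = concaveCoeff (a d) α d k :=
  h.coeff_eq_of_lt h0 hd hk.le (h.lt_of_isVertexAbscissa h0 hd ha hk)

theorem coeff_zero_eq_mul_prod (h : IsTropicalRoots a d α) (h0 : 0 < a 0) (hd : 0 < a d)
    (ha : ∀ i, 0 ≤ a i) {k : ℕ} (hk : IsVertexAbscissa a d k) :
    a 0 = a k * ∏ i ∈ Finset.Icc 1 k, α i := by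
  rw [h.coeff_zero_eq h0, h.coeff_eq_of_isVertexAbscissa h0 hd ha hk]
  exact concaveCoeff_eq_mul_prod _ _ (Nat.zero_le k) hk.le

/-- The coefficients decay geometrically away from a vertex, at different rates on both sides. -/
theorem coeff_mul_pow_le (h : IsTropicalRoots a d α) (h0 : 0 < a 0) (hd : 0 < a d)
    (ha : ∀ i, 0 ≤ a i) {k : ℕ} (hk : IsVertexAbscissa a d k) (hkd : k < d) {m : ℕ} (hm : m ≤ d) :
    a m * α (k + 1) ^ (m - k) ≤ a k * α k ^ (k - m) := by
  have hb := h.coeff_le h0 hm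
  have hak := h.coeff_eq_of_isVertexAbscissa h0 hd ha hk
  rcases le_total m k with hmk | hmk
  · rw [Nat.sub_eq_zero_of_le hmk, pow_zero, mul_one]
    refine hb.trans ?_
    rw [concaveCoeff_eq_mul_prod _ _ hmk hkd.le, ← hak]
    refine mul_le_mul_of_nonneg_left ?_ (ha k)
    rw [← Nat.card_Ioc, ← Finset.prod_const]
    refine Finset.prod_le_prod ?_ ?_ <;> intro i hi <;> rw [Finset.mem_Ioc] at hi
    · exact (h.pos h0 (by omega) (by omega)).le
    · exact h.1 ⟨by omega, by omega⟩ ⟨by omega, hkd.le⟩ hi.2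
  · rw [Nat.sub_eq_zero_of_le hmk, pow_zero, mul_one, hak, concaveCoeff_eq_mul_prod _ _ hmk hm]
    refine mul_le_mul hb ?_ (pow_nonneg (h.pos h0 (by omega) hkd).le _)
      (h.concaveCoeff_pos h0 hd m).le
    rw [← Nat.card_Ioc, ← Finset.prod_const]
    refine Finset.prod_le_prod ?_ ?_ <;> intro i hi <;> rw [Finset.mem_Ioc] at hi
    · exact (h.pos h0 (by omega) hkd).le
    · exact h.1 ⟨by omega, hkd⟩ ⟨by omega, by omega⟩ hi.1

/-- The total excess `s` of `φ` above `k` equals its total deficit below. The decay estimates then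
multiply to `(α k / α (k + 1)) ^ s`, and `s ≥ 1` since `φ` is not constantly `k`. -/
theorem prod_coeff_le {n : ℕ} (h : IsTropicalRoots a d α) (h0 : 0 < a 0) (hd : 0 < a d)
    (ha : ∀ i, 0 ≤ a i) {k : ℕ} (hk : IsVertexAbscissa a d k) (φ : Fin n → Fin (d + 1))
    (hsum : ∑ i, (φ i : ℕ) = n * k) (hφ : ∃ i, (φ i : ℕ) ≠ k) :
    ∏ i, a (φ i) ≤ a k ^ n * separation d α k := by
  have hbal : ∑ i, ((φ i : ℕ) - k) = ∑ i, (k - (φ i : ℕ)) := by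
    have h1 : ∑ i, ((φ i : ℕ) - k) + n * k = ∑ i, (k - (φ i : ℕ)) + ∑ i, (φ i : ℕ) := by
      rw [← Finset.sum_add_distrib]
      have : n * k = ∑ _i : Fin n, k := by simp
      rw [this, ← Finset.sum_add_distrib]
      exact Finset.sum_congr rfl fun i _ => by omega
    omega
  obtain ⟨i₀, hi₀⟩ := hφ
  have hpos : 0 < ∑ i, ((φ i : ℕ) - k) := by
    rcases lt_or_gt_of_ne hi₀ with h1 | h1
    · rw [hbal]
      exact Finset.sum_pos' (fun _ _ => Nat.zero_le _) ⟨i₀, Finset.mem_univ _, by omega⟩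
    · exact Finset.sum_pos' (fun _ _ => Nat.zero_le _) ⟨i₀, Finset.mem_univ _, by omega⟩
  -- Some value exceeds `k` and some value is below it, so `k` is neither `0` nor `d` and
  -- `separation` is the true quotient.
  have hkd : k < d := by
    obtain ⟨i, -, hi⟩ := Finset.exists_ne_zero_of_sum_ne_zero hpos.ne'
    have := (φ i).isLt
    omega
  have hk1 : 1 ≤ k := by
    obtain ⟨i, -, hi⟩ := Finset.exists_ne_zero_of_sum_ne_zero (hbal ▸ hpos).ne'
    omega
  rw [separation, if_neg (by omega)]
  set s := ∑ i, ((φ i : ℕ) - k) with hs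
  have hp := h.pos h0 hk1 hkd.le
  have hp' := h.pos h0 (Nat.le_add_left 1 k) hkd
  have hle : α k ≤ α (k + 1) := h.1 ⟨hk1, hkd.le⟩ ⟨by omega, hkd⟩ (Nat.le_succ k)
  have hprod : (∏ i, a (φ i)) * α (k + 1) ^ s ≤ a k ^ n * α k ^ s := by
    have h1 : ∏ i, (a (φ i) * α (k + 1) ^ ((φ i : ℕ) - k)) ≤
        ∏ i, (a k * α k ^ (k - (φ i : ℕ))) :=
      Finset.prod_le_prod (fun i _ => mul_nonneg (ha _) (pow_nonneg hp'.le _)) fun i _ =>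
        h.coeff_mul_pow_le h0 hd ha hk hkd (Nat.le_of_lt_succ (φ i).isLt)
    rw [Finset.prod_mul_distrib, Finset.prod_mul_distrib, Finset.prod_pow_eq_pow_sum,
      Finset.prod_pow_eq_pow_sum, ← hbal, ← hs] at h1
    simpa using h1
  calc ∏ i, a (φ i) ≤ a k ^ n * α k ^ s / α (k + 1) ^ s := (le_div_iff₀ (pow_pos hp' s)).2 hprod
    _ = a k ^ n * (α k / α (k + 1)) ^ s := by rw [div_pow, mul_div_assoc]
    _ ≤ a k ^ n * (α k / α (k + 1)) :=
      mul_le_mul_of_nonneg_left (pow_le_of_le_one (by positivity) ((div_le_one hp').2 hle) hpos.ne')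
        (pow_nonneg (ha k) n)

end IsTropicalRoots

/-! ### Products of the smallest roots, with infinite roots allowed. -/

theorem modulus_coe (z : ℂ) : modulus (z : OnePoint ℂ) = ‖z‖ₑ := ofReal_norm z

theorem enorm_prod {ι : Type*} (s : Finset ι) (z : ι → ℂ) : ‖∏ i ∈ s, z i‖ₑ = ∏ i ∈ s, ‖z i‖ₑ := by
  simp [enorm_eq_nnnorm]

theorem prod_Icc_le_prod_of_monotoneOn {f : ℕ → ENNReal} {M : ℕ}
    (hf : MonotoneOn f (Set.Icc 1 M)) (U : Finset ℕ) (hU : U ⊆ Finset.Icc 1 M) :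
    ∏ i ∈ Finset.Icc 1 U.card, f i ≤ ∏ i ∈ U, f i := by
  -- The largest element of a set of positive integers is at least its cardinality, so monotonicity
  -- compares the top factors.
  induction U using Finset.induction_on_max with
  | empty => simp
  | insert u U hlt ih =>
    have hu : u ∉ U := fun h => lt_irrefl u (hlt u h)
    have hsub : insert u U ⊆ Finset.Icc 1 u := by
      intro i hi
      refine Finset.mem_Icc.2 ⟨(Finset.mem_Icc.1 (hU hi)).1, ?_⟩
      rcases Finset.mem_insert.1 hi with rfl | h
      · exact le_rfl
      · exact (hlt i h).le
    have hcard := Finset.card_le_card hsub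
    have huM := Finset.mem_Icc.1 (hU (Finset.mem_insert_self u U))
    rw [Nat.card_Icc, Finset.card_insert_of_notMem hu] at hcard
    rw [Finset.card_insert_of_notMem hu, Finset.prod_insert hu,
      Finset.prod_Icc_succ_top (Nat.le_add_left 1 _), mul_comm]
    exact mul_le_mul' (hf ⟨by omega, by omega⟩ huM (by omega))
      (ih ((Finset.subset_insert u U).trans hU))

/-- A sequence that enumerates a multiset of complex numbers and some copies of `∞` enumerates the
multiset on its finite part. -/
theorem exists_enumeration {M r : ℕ} {s : Multiset ℂ} {ζ : ℕ → OnePoint ℂ}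
    (hζ : (Finset.Icc 1 M).val.map ζ =
      s.map (fun z : ℂ => (z : OnePoint ℂ)) + Multiset.replicate r OnePoint.infty) :
    ∃ S ⊆ Finset.Icc 1 M, ∃ z : ℕ → ℂ, (∀ i ∈ S, ζ i = (z i : OnePoint ℂ)) ∧ s = S.val.map z := by
  classical
  let g : OnePoint ℂ → ℂ := fun w => OnePoint.elim w 0 id
  have hg : ∀ w : ℂ, g (w : OnePoint ℂ) = w := fun _ => rfl
  refine ⟨(Finset.Icc 1 M).filter (fun i => ζ i ≠ OnePoint.infty), Finset.filter_subset _ _,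
    fun i => g (ζ i), ?_, ?_⟩
  · intro i hi
    obtain ⟨w, hw⟩ := OnePoint.ne_infty_iff_exists.1 (Finset.mem_filter.1 hi).2
    simp only [← hw, hg]
  · have h1 := congrArg (fun t => (t.filter (fun w => w ≠ OnePoint.infty)).map g) hζ
    simp only [Multiset.filter_map, Multiset.filter_add, Multiset.map_add, Multiset.map_map] at h1
    rw [Multiset.filter_eq_nil (s := Multiset.replicate r OnePoint.infty) |>.2] at h1
    · rw [Multiset.filter_eq_self (s := s) |>.2] at h1
      · rw [Finset.filter_val]
        simpa [Function.comp_def, hg] using h1.symm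
      · intro w _
        exact OnePoint.coe_ne_infty w
    · intro w hw
      simpa using (Multiset.mem_replicate.1 hw).2

theorem prod_modulus_mul_coeff_le {p : ℂ[X]} {M K : ℕ} (hM : p.natDegree ≤ M)
    {ζ : ℕ → OnePoint ℂ}
    (hζ : (Finset.Icc 1 M).val.map ζ = p.roots.map (fun z : ℂ => (z : OnePoint ℂ)) +
      Multiset.replicate (M - p.natDegree) OnePoint.infty)
    (hmono : MonotoneOn (fun i => modulus (ζ i)) (Set.Icc 1 M)) (hK : p.coeff K ≠ 0) :
    (∏ i ∈ Finset.Icc 1 K, modulus (ζ i)) * ‖p.coeff K‖ₑ ≤ M.choose K * ‖p.coeff 0‖ₑ := by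
  have hKD : K ≤ p.natDegree := le_natDegree_of_ne_zero hK
  have hsplit : p.Splits := IsAlgClosed.splits p
  obtain ⟨S, hSM, z, hz, hroots⟩ := exists_enumeration hζ
  have hcard : S.card = p.natDegree := by
    rw [hsplit.natDegree_eq_card_roots, hroots, Multiset.card_map, Finset.card_val]
  have hcK : ‖p.coeff K‖ₑ ≤ ‖p.leadingCoeff‖ₑ *
      ∑ T ∈ S.powersetCard (p.natDegree - K), ∏ i ∈ T, ‖z i‖ₑ := by
    rw [coeff_eq_esymm_roots_of_splits hsplit hKD, hroots, Finset.esymm_map_val]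
    simp only [enorm_mul, enorm_pow, enorm_neg, enorm_one, one_pow, mul_one]
    refine mul_le_mul_right ((enorm_sum_le _ _).trans_eq ?_) _
    exact Finset.sum_congr rfl fun T _ => enorm_prod _ _
  have hc0 : ‖p.coeff 0‖ₑ = ‖p.leadingCoeff‖ₑ * ∏ i ∈ S, ‖z i‖ₑ := by
    rw [hsplit.coeff_zero_eq_leadingCoeff_mul_prod_roots, hroots]
    simp only [enorm_mul, enorm_pow, enorm_neg, enorm_one, one_pow, one_mul]
    congr 1
    exact enorm_prod _ _
  have hT : ∀ T ∈ S.powersetCard (p.natDegree - K),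
      (∏ i ∈ Finset.Icc 1 K, modulus (ζ i)) * ∏ i ∈ T, ‖z i‖ₑ ≤ ∏ i ∈ S, ‖z i‖ₑ := by
    intro T hT
    rw [Finset.mem_powersetCard] at hT
    -- The `K` roots missing from `T` have a product of modulus at least that of the first `K`
    -- eigenvalues.
    have hU : (S \ T).card = K := by
      rw [Finset.card_sdiff_of_subset hT.1, hcard, hT.2]
      omega
    have h1 := prod_Icc_le_prod_of_monotoneOn hmono (S \ T) (Finset.sdiff_subset.trans hSM)
    rw [hU, Finset.prod_congr rfl (s₁ := S \ T) (g := fun i => ‖z i‖ₑ) fun i hi => by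
      rw [hz i (Finset.sdiff_subset hi), modulus_coe]] at h1
    rw [← Finset.prod_sdiff hT.1]
    exact mul_le_mul_left h1 _
  calc _ ≤ (∏ i ∈ Finset.Icc 1 K, modulus (ζ i)) * (‖p.leadingCoeff‖ₑ *
        ∑ T ∈ S.powersetCard (p.natDegree - K), ∏ i ∈ T, ‖z i‖ₑ) := mul_le_mul_right hcK _
    _ = ‖p.leadingCoeff‖ₑ * ∑ T ∈ S.powersetCard (p.natDegree - K),
        (∏ i ∈ Finset.Icc 1 K, modulus (ζ i)) * ∏ i ∈ T, ‖z i‖ₑ := by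
      rw [← Finset.mul_sum]; ring
    _ ≤ ‖p.leadingCoeff‖ₑ * ∑ T ∈ S.powersetCard (p.natDegree - K), ∏ i ∈ S, ‖z i‖ₑ :=
      mul_le_mul_right (Finset.sum_le_sum hT) _
    _ = p.natDegree.choose K * ‖p.coeff 0‖ₑ := by
      rw [Finset.sum_const, Finset.card_powersetCard, hcard, Nat.choose_symm hKD, hc0,
        nsmul_eq_mul]
      ring
    _ ≤ _ := mul_le_mul_left (by exact_mod_cast Nat.choose_le_choose K hM) _

/-! ### Lower bound for the vertex coefficient, and conclusion. -/

theorem norm_det_mixedColumns_le {n : ℕ} (N : Seminorm ℂ (Matrix (Fin n) (Fin n) ℂ))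
    (hN : ∀ M : Matrix (Fin n) (Fin n) ℂ, N M = 0 → M = 0)
    (A : ℕ → Matrix (Fin n) (Fin n) ℂ) (φ : Fin n → ℕ) :
    ‖(mixedColumns A φ).det‖ ≤ (∏ i, columnConst N i) * ∏ i, N (A (φ i)) := by
  rw [← Finset.prod_mul_distrib]
  exact (norm_det_le_prod_norm_col _).trans <|
    Finset.prod_le_prod (fun _ _ => norm_nonneg _) fun i _ =>
      (isLeast_columnConst N hN i).1.2 (A (φ i))

/-- The central coefficient attached to a vertex of the Newton polygon is bounded below. -/
theorem vertexConst_mul_le_norm_coeff {n d k : ℕ} (N : Seminorm ℂ (Matrix (Fin n) (Fin n) ℂ))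
    (hN : ∀ M : Matrix (Fin n) (Fin n) ℂ, N M = 0 → M = 0)
    (A : ℕ → Matrix (Fin n) (Fin n) ℂ) {α : ℕ → ℝ}
    (hα : IsTropicalRoots (fun j => N (A j)) d α) (h0 : 0 < N (A 0)) (hd : 0 < N (A d))
    (hk : IsVertexAbscissa (fun j => N (A j)) d k) (hAk : 0 < N (A k)) :
    vertexConst N A d α k * N (A k) ^ n ≤ ‖(matPoly A d).det.coeff (n * k)‖ := by
  classical
  set F := Finset.univ.filter (fun φ : Fin n → Fin (d + 1) => ∑ i, (φ i : ℕ) = n * k) with hF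
  let φ₀ : Fin n → Fin (d + 1) := fun _ => ⟨k, Nat.lt_succ_of_le hk.le⟩
  have hφ₀ : φ₀ ∈ F := by simp [hF, φ₀]
  have hη : 0 ≤ ∏ i, columnConst N i :=
    Finset.prod_nonneg fun i _ => (isLeast_columnConst N hN i).1.1.le
  set B := (∏ i, columnConst N i) * (N (A k) ^ n * separation d α k) with hB
  have hrest : ‖∑ φ ∈ F.erase φ₀, (mixedColumns A (fun i => φ i)).det‖ ≤
      ((mapCount n d (n * k) : ℝ) - 1) * B := by
    have hc : ((F.erase φ₀).card : ℝ) = (mapCount n d (n * k) : ℝ) - 1 := by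
      rw [Finset.card_erase_of_mem hφ₀, Nat.cast_sub (Finset.card_pos.2 ⟨φ₀, hφ₀⟩), Nat.cast_one]
      rfl
    rw [← hc, ← nsmul_eq_mul]
    refine (norm_sum_le _ _).trans (Finset.sum_le_card_nsmul _ _ _ fun φ hφ => ?_)
    rw [Finset.mem_erase, hF, Finset.mem_filter] at hφ
    refine (norm_det_mixedColumns_le N hN A _).trans (mul_le_mul_of_nonneg_left ?_ hη)
    refine hα.prod_coeff_le h0 hd (fun i => apply_nonneg N (A i)) hk φ hφ.2.2 ?_
    by_contra! h
    exact hφ.1 (funext fun i => Fin.ext (h i))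
  have hconst : (mixedColumns A (fun i => φ₀ i)).det = (A k).det := rfl
  have hsum : (matPoly A d).det.coeff (n * k) =
      (A k).det + ∑ φ ∈ F.erase φ₀, (mixedColumns A (fun i => φ i)).det := by
    rw [coeff_det_matPoly, ← hF, ← Finset.add_sum_erase F _ hφ₀, hconst]
  have hv : vertexConst N A d α k * N (A k) ^ n =
      ‖(A k).det‖ - ((mapCount n d (n * k) : ℝ) - 1) * B := by
    rw [vertexConst, detRatio, hB, sub_mul, div_mul_cancel₀ _ (pow_pos hAk n).ne']
    ring
  rw [hv, hsum]
  have := norm_sub_le_norm_add (A k).det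
    (∑ φ ∈ F.erase φ₀, (mixedColumns A (fun i => φ i)).det)
  linarith

theorem coeff_zero_det_matPoly {n : ℕ} (A : ℕ → Matrix (Fin n) (Fin n) ℂ) (d : ℕ) :
    (matPoly A d).det.coeff 0 = (A 0).det := by
  have h : Finset.univ.filter (fun φ : Fin n → Fin (d + 1) => ∑ i, (φ i : ℕ) = 0) = {0} := by
    ext φ
    simp [funext_iff]
  rw [coeff_det_matPoly, h, Finset.sum_singleton]
  rfl

theorem prod_modulus_div_le {n d k : ℕ} (N : Seminorm ℂ (Matrix (Fin n) (Fin n) ℂ))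
    (hN : ∀ M : Matrix (Fin n) (Fin n) ℂ, N M = 0 → M = 0)
    (A : ℕ → Matrix (Fin n) (Fin n) ℂ) (h0 : 0 < N (A 0)) (hd : 0 < N (A d))
    {ζ : ℕ → OnePoint ℂ} (hζ : IsEigenvalueSeq A d ζ) {α : ℕ → ℝ}
    (hα : IsTropicalRoots (fun j => N (A j)) d α)
    (hk : IsVertexAbscissa (fun j => N (A j)) d k) (hv : 0 < vertexConst N A d α k) :
    (∏ i ∈ Finset.Icc 1 (n * k), modulus (ζ i)) /
        ENNReal.ofReal ((∏ i ∈ Finset.Icc 1 k, α i) ^ n) ≤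
      ENNReal.ofReal (detRatio N (A 0) / vertexConst N A d α k * ((n * d).choose (n * k) : ℝ)) := by
  have ha : ∀ i, 0 ≤ N (A i) := fun i => apply_nonneg N (A i)
  have hAk : 0 < N (A k) :=
    (hα.coeff_eq_of_isVertexAbscissa h0 hd ha hk).symm ▸ hα.concaveCoeff_pos h0 hd k
  have hQ : 0 < ∏ i ∈ Finset.Icc 1 k, α i := Finset.prod_pos fun i hi =>
    hα.pos h0 (Finset.mem_Icc.1 hi).1 ((Finset.mem_Icc.1 hi).2.trans hk.le)
  have hA0 : N (A 0) = N (A k) * ∏ i ∈ Finset.Icc 1 k, α i :=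
    hα.coeff_zero_eq_mul_prod h0 hd ha hk
  set Q := ∏ i ∈ Finset.Icc 1 k, α i
  set v := vertexConst N A d α k
  have hlow : v * N (A k) ^ n ≤ ‖(matPoly A d).det.coeff (n * k)‖ :=
    vertexConst_mul_le_norm_coeff N hN A hα h0 hd hk hAk
  have hvN : 0 < v * N (A k) ^ n := mul_pos hv (pow_pos hAk n)
  have hcoeff : (matPoly A d).det.coeff (n * k) ≠ 0 := norm_pos_iff.1 (hvN.trans_le hlow)
  have hmain := prod_modulus_mul_coeff_le (natDegree_det_matPoly_le A d) hζ.1 hζ.2 hcoeff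
  rw [coeff_zero_det_matPoly, ← ofReal_norm, ← ofReal_norm, ← ENNReal.ofReal_natCast,
    ← ENNReal.ofReal_mul (Nat.cast_nonneg _)] at hmain
  have hP : ∏ i ∈ Finset.Icc 1 (n * k), modulus (ζ i) ≤
      ENNReal.ofReal ((n * d).choose (n * k) * ‖(A 0).det‖ / (v * N (A k) ^ n)) := by
    rw [ENNReal.ofReal_div_of_pos hvN, ENNReal.le_div_iff_mul_le
      (Or.inl (ENNReal.ofReal_pos.2 hvN).ne') (Or.inl ENNReal.ofReal_ne_top)]
    exact (mul_le_mul_right (ENNReal.ofReal_le_ofReal hlow) _).trans hmain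
  refine ENNReal.div_le_of_le_mul (hP.trans_eq ?_)
  rw [← ENNReal.ofReal_mul' (pow_pos hQ n).le, detRatio, hA0]
  congr 1
  field_simp
  rw [mul_pow]
  ring

end MatrixPolyBound

theorem theorem5p1 {n d q : ℕ}
    (N : Seminorm ℂ (Matrix (Fin n) (Fin n) ℂ))
    (hN : ∀ M : Matrix (Fin n) (Fin n) ℂ, N M = 0 → M = 0)
    (A : ℕ → Matrix (Fin n) (Fin n) ℂ)
    (hd : A d ≠ 0)
    (h0 : (A 0).det ≠ 0)
    (ζ : ℕ → OnePoint ℂ)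
    (hζ : MatrixPolyBound.IsEigenvalueSeq A d ζ)
    (α : ℕ → ℝ)
    (hα : MatrixPolyBound.IsTropicalRoots (fun j => N (A j)) d α)
    (k : Fin (q + 1) → ℕ)
    (hk : StrictMono k)
    (hkv : Set.range k = {m : ℕ | MatrixPolyBound.IsVertexAbscissa (fun j => N (A j)) d m}) :
    (∀ m : ℕ, m ≤ n * d →
      MatrixPolyBound.mapCount n d m ≤ (min d (min m (n * d - m)) + 1) ^ (n - 1)) ∧
    ∀ j : Fin (q + 1), 1 ≤ (j : ℕ) →
      0 < MatrixPolyBound.vertexConst N A d α (k j) →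
      (∏ i ∈ Finset.Icc 1 (n * k j), MatrixPolyBound.modulus (ζ i)) /
          ENNReal.ofReal ((∏ i ∈ Finset.Icc 1 (k j), α i) ^ n) ≤
        ENNReal.ofReal
          (MatrixPolyBound.detRatio N (A 0) / MatrixPolyBound.vertexConst N A d α (k j) *
            ((n * d).choose (n * k j) : ℝ)) := by
  -- All `0 × 0` matrices coincide, so `A d ≠ 0` excludes `n = 0`.
  have hn : n ≠ 0 := by
    rintro rfl
    exact hd (Subsingleton.elim _ _)
  have hpos : ∀ M : Matrix (Fin n) (Fin n) ℂ, M ≠ 0 → 0 < N M := fun M hM =>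
    lt_of_le_of_ne (apply_nonneg N M) fun h => hM (hN M h.symm)
  have hA0 : A 0 ≠ 0 := by
    have : Nonempty (Fin n) := Fin.pos_iff_nonempty.1 (Nat.pos_of_ne_zero hn)
    intro h
    exact h0 (by rw [h, Matrix.det_zero])
  refine ⟨fun m _ => MatrixPolyBound.mapCount_le hn, fun j _ hv => ?_⟩
  have hkj : MatrixPolyBound.IsVertexAbscissa (fun j => N (A j)) d (k j) :=
    hkv.subset (Set.mem_range_self j)
  exact MatrixPolyBound.prod_modulus_div_le N hN A (hpos _ hA0) (hpos _ hd) hζ hα hkj hv
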